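/- Let $R$ be a commutative noetherian ring, and work in the derived category $\mathsf{D}(R)$ of $R$-modules. An $R$-module is \emph{Gorenstein projective} if it is isomorphic to $\ker(P^0\to P^1)$ for some exact complex $P=(\cdots\to P^{-1}\to P^0\to P^1\to\cdots)$ of projective $R$-modules such that $\operatorname{Hom}_R(P,Q)$ is exact for every projective $R$-module $Q$. Let $\mathsf{G}$ be the collection of finitely generated Gorenstein projective $R$-modules, viewed as complexes concentrated in degree $0$. A complex is \emph{perfect} if it is isomorphic in $\mathsf{D}(R)$ to a bounded complex of finitely generated projective $R$-modules. The \emph{$\mathsf{G}$-level} of a complex $M$, denoted $\operatorname{level}_{\mathsf{G}}(M)$, is the least integer $n\ge 0$ such that $M$ can be built from $\mathsf{G}$ in $n$ steps (and $\infty$ if there is no such $n$). Here $M$ can be built in $0$ steps if $M\simeq 0$; in $1$ step if it is a direct summand of a finite direct sum of shifts of modules in $\mathsf{G}$; and in $n\ge 2$ steps if there is an exact triangle $K\to L\oplus M\to N\to\Sigma K$ in which $K$ can be built in $1$ step and $N$ in $n-1$ steps. \textbf{Theorem.} If there exists an integer $d$ such that $\operatorname{level}_{\mathsf{G}}(P)\le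 d+1$ holds for every perfect $R$-complex $P$, then $R$ is Gorenstein of Krull dimension at most $d$; that is, for every prime ideal $\mathfrak{p}$ of $R$ the local ring $R_{\mathfrak{p}}$ has finite injective dimension as a module over itself, and $\dim R\le d$ (where the zero ring has dimension $-\infty$). -/

import Mathlib

open CategoryTheory CategoryTheory.Limits CategoryTheory.Pretriangulated

universe w u

noncomputable section

namespace GLevel

section Level

variable {T : Type*} [Category T] [HasZeroObject T] [HasShift T ℤ] [Preadditive T]
  [∀ n : ℤ, (shiftFunctor T n).Additive] [Pretriangulated T]

/-- The objects of a triangulated category that can be built from the objects in `C` using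
shifts, (nonempty) finite direct sums and direct summands. -/
def built (C : ObjectProperty T) : ObjectProperty T :=
  (C.shiftClosure ℤ).binaryProductsClosure.retractClosure

/-- `thick C n` is the collection of objects that can be built from `C` in `n` steps:
* `n = 0`: the zero objects;
* `n = 1`: the objects built from `C` by shifts, finite direct sums and summands;
* `n ≥ 2`: the objects `M` for which there is an exact triangle `K ⟶ L ⊕ M ⟶ N ⟶ K⟦1⟧` with
  `K` built in one step and `N` built in `n - 1` steps. -/
def thick (C : ObjectProperty T) : ℕ → ObjectProperty T
  | 0 => fun M => IsZero M
  | 1 => built C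
  | n + 2 => fun M => ∃ (K L N : T) (f : K ⟶ L ⊞ M) (g : L ⊞ M ⟶ N) (h : N ⟶ K⟦(1 : ℤ)⟧),
      Triangle.mk f g h ∈ distTriang T ∧ built C K ∧ thick C (n + 1) N

/-- The level of `M` with respect to `C`: the least number of steps in which `M` can be built
from `C`, and `⊤` if `M` cannot be built from `C`. -/
def level (C : ObjectProperty T) (M : T) : ℕ∞ :=
  sInf {e : ℕ∞ | ∃ n : ℕ, e = n ∧ thick C n M}

end Level

section Modules

variable (R : Type u) [CommRing R]

/-- A totally acyclic complex of projective modules: an exact complex `P` of projective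
modules, indexed by `ℤ`, such that `Hom(P, Q)` is exact for every projective module `Q`
(every map `P n ⟶ Q` that vanishes on the image of `P (n - 1)` extends along
`P n ⟶ P (n + 1)`). -/
structure IsTotallyAcyclic (P : CochainComplex (ModuleCat.{u} R) ℤ) : Prop where
  projective : ∀ n : ℤ, Projective (P.X n)
  exact : ∀ n : ℤ, P.ExactAt n
  hom_exact : ∀ Q : ModuleCat.{u} R, Projective Q → ∀ (n : ℤ) (f : P.X n ⟶ Q),
    P.d (n - 1) n ≫ f = 0 → ∃ g : P.X (n + 1) ⟶ Q, P.d n (n + 1) ≫ g = f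

/-- A module is Gorenstein projective if it is isomorphic to a module of cycles in a totally
acyclic complex of projective modules. -/
def IsGorensteinProjective (M : ModuleCat.{u} R) : Prop :=
  ∃ P : CochainComplex (ModuleCat.{u} R) ℤ,
    IsTotallyAcyclic R P ∧ Nonempty (M ≅ P.cycles 0)

variable [HasDerivedCategory.{w} (ModuleCat.{u} R)]

/-- The collection of finitely generated Gorenstein projective `R`-modules, considered as
complexes concentrated in degree `0` in the derived category of `R`. -/
def finGorensteinProjective : ObjectProperty (DerivedCategory (ModuleCat.{u} R)) := fun X =>
  ∃ M : ModuleCat.{u} R, Module.Finite R M ∧ IsGorensteinProjective R M ∧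
    Nonempty (X ≅ (DerivedCategory.singleFunctor (ModuleCat.{u} R) 0).obj M)

/-- A complex is perfect if it is isomorphic in the derived category to a bounded complex of
finitely generated projective modules. -/
def IsPerfect (X : DerivedCategory (ModuleCat.{u} R)) : Prop :=
  ∃ P : CochainComplex (ModuleCat.{u} R) ℤ,
    (∀ n : ℤ, Module.Finite R (P.X n) ∧ Projective (P.X n)) ∧
    (∃ a b : ℤ, P.IsStrictlyGE a ∧ P.IsStrictlyLE b) ∧
    Nonempty (X ≅ DerivedCategory.Q.obj P)

end Modules

/-- A (noetherian) ring is Gorenstein if each of its localizations at prime ideals has finite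
injective dimension as a module over itself. -/
def IsGorenstein (R : Type u) [CommRing R] : Prop :=
  ∀ (p : Ideal R) [p.IsPrime], ∃ n : ℕ,
    HasInjectiveDimensionLE (ModuleCat.of (Localization.AtPrime p) (Localization.AtPrime p)) n

end GLevel

end

/-! Let t = max(d + 1, 0). A class in Ext^t(M, R), seen as a morphism M ⟶ R⟦t⟧, is a morphism
followed by t connecting morphisms of the sequences 0 → C → I → C' → 0 that make up an injective
resolution of R. These are ghost for the Gorenstein projective modules G, since Ext^i(G, C) = 0 for
all i > 0 (`isGhostPow_ext_hom`). By the ghost lemma (`IsGhostPow.eq_zero_of_thick`) the class dies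
on every complex of level at most t mapping to M.

For M finitely generated, let P ⟶ M be a free resolution truncated beyond degree t. The class dies
on the perfect complex P, so it factors through the cone of P ⟶ M, which lies in degrees too low to
map to R⟦t⟧. Hence Ext^t(M, R) = 0 (`ext_eq_zero_of_thick`), and R has injective dimension less than
t by Baer's criterion (`hasInjectiveDimensionLT_of_finite`). This passes to localizations, and by
Bass' lemma it bounds the Krull dimension (`lt_of_le_ringKrullDim`). -/

namespace GLevel

/-! ### Ghost morphisms and the ghost lemma. -/

section Ghost

variable {T : Type*} [Category T] [HasShift T ℤ] [Preadditive T]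

/-- A morphism is `C`-ghost if it is annihilated by all morphisms from shifts of objects
of `C`. -/
def IsGhost (C : ObjectProperty T) {A B : T} (f : A ⟶ B) : Prop :=
  ∀ ⦃X : T⦄, C.shiftClosure ℤ X → ∀ g : X ⟶ A, g ≫ f = 0

lemma IsGhost.comp {C : ObjectProperty T} {A B B' : T} {f : A ⟶ B} (hf : IsGhost C f)
    (g : B ⟶ B') : IsGhost C (f ≫ g) := fun X hX x => by
  rw [← Category.assoc, hf hX, zero_comp]

/-- `IsGhostPow C n f` says that `f` is a composition of `n` `C`-ghost morphisms followed by
another morphism. -/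
def IsGhostPow (C : ObjectProperty T) : ℕ → ∀ {A B : T}, (A ⟶ B) → Prop
  | 0, _, _, _ => True
  | n + 1, A, B, f => ∃ (A' : T) (g : A ⟶ A') (f' : A' ⟶ B),
      g ≫ f' = f ∧ IsGhost C g ∧ IsGhostPow C n f'

variable {C : ObjectProperty T}

lemma IsGhost.precomp {A B : T} {f : A ⟶ B} (hf : IsGhost C f) {A' : T} (g : A' ⟶ A) :
    IsGhost C (g ≫ f) := fun X hX x => by
  rw [← Category.assoc, hf hX]

lemma IsGhostPow.precomp {n : ℕ} {A B : T} {f : A ⟶ B} (hf : IsGhostPow C n f) {A' : T}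
    (g : A' ⟶ A) : IsGhostPow C n (g ≫ f) := by
  cases n with
  | zero => trivial
  | succ n =>
    obtain ⟨Z, f₁, f₂, rfl, h₁, h₂⟩ := hf
    exact ⟨Z, g ≫ f₁, f₂, by simp, h₁.precomp g, h₂⟩

lemma IsGhostPow.comp_isGhost {n : ℕ} {A B B' : T} {f : A ⟶ B} (hf : IsGhostPow C n f)
    {g : B ⟶ B'} (hg : IsGhost C g) : IsGhostPow C (n + 1) (f ≫ g) := by
  induction n generalizing A with
  | zero => exact ⟨B', f ≫ g, 𝟙 _, by simp, hg.precomp f, trivial⟩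
  | succ n ih =>
    obtain ⟨Z, f₁, f₂, rfl, h₁, h₂⟩ := hf
    exact ⟨Z, f₁, f₂ ≫ g, by simp, h₁, ih h₂⟩

/-- Surplus ghosts are absorbed into the final factor. This makes monotonicity of `thick` in `n`
unnecessary. -/
lemma IsGhostPow.of_le {m n : ℕ} {A B : T} {f : A ⟶ B} (hf : IsGhostPow C n f)
    (h : m ≤ n) : IsGhostPow C m f := by
  induction m generalizing n A with
  | zero => trivial
  | succ m ih =>
    obtain _ | n := n
    · omega
    · obtain ⟨Z, f₁, f₂, h₀, h₁, h₂⟩ := hf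
      exact ⟨Z, f₁, f₂, h₀, h₁, ih h₂ (by omega)⟩

variable [HasZeroObject T] [∀ n : ℤ, (shiftFunctor T n).Additive] [Pretriangulated T]

lemma IsGhost.eq_zero_of_built {A B : T} {f : A ⟶ B} (hf : IsGhost C f) {X : T}
    (hX : built C X) (g : X ⟶ A) : g ≫ f = 0 := by
  let P : ObjectProperty T := fun X => ∀ g : X ⟶ A, g ≫ f = 0
  have h₁ : (C.shiftClosure ℤ).binaryProductsClosure ≤ P := by
    intro Y hY
    induction hY with
    | of_mem X hX => exact hf hX
    | of_isoClosure e _ ih =>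
      intro g
      rw [← cancel_epi e.hom, ← Category.assoc, ih, comp_zero]
    | of_limitPresentation p _ ih =>
      intro g
      let e := p.isLimit.conePointsIsoOfNatIso (limit.isLimit _) (diagramIsoPair p.diag) ≪≫
        (biprod.isoProd _ _).symm
      rw [← cancel_epi e.inv, comp_zero, ← Category.assoc]
      ext
      · rw [← Category.assoc, ih, comp_zero]
      · rw [← Category.assoc, ih, comp_zero]
  obtain ⟨Y, hY, ⟨r⟩⟩ := hX
  rw [← cancel_epi r.r, ← Category.assoc, h₁ _ hY, comp_zero]

/-- The ghost lemma. -/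
lemma IsGhostPow.eq_zero_of_thick {n : ℕ} {A B : T} {f : A ⟶ B} (hf : IsGhostPow C n f)
    (hA : thick C n A) : f = 0 := by
  induction n using Nat.twoStepInduction generalizing A with
  | zero => exact IsZero.eq_of_src hA _ _
  | one =>
    obtain ⟨Z, f₁, f₂, rfl, h₁, -⟩ := hf
    rw [← Category.id_comp f₁, h₁.eq_zero_of_built hA, zero_comp]
  | more n _ ih =>
    obtain ⟨Z, f₁, f₂, rfl, h₁, h₂⟩ := hf
    obtain ⟨K, L, N, a, b, c, hT, hK, hN⟩ := hA
    -- The first ghost kills `K`, hence factors through `N`; the remaining ones are left for `N`.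
    obtain ⟨g, h⟩ : ∃ g : N ⟶ Z, biprod.snd ≫ f₁ = b ≫ g :=
      Triangle.yoneda_exact₂ _ hT (biprod.snd ≫ f₁)
        ((Category.assoc _ _ _).symm.trans (h₁.eq_zero_of_built hK (a ≫ biprod.snd)))
    rw [← cancel_epi (biprod.snd : L ⊞ A ⟶ A), ← Category.assoc, h, Category.assoc,
      ih (h₂.precomp g) hN, comp_zero, comp_zero]

lemma exists_thick_of_level_eq {M : T} {l : ℕ} (h : level C M = l) : thick C l M := by
  have hne : {e : ℕ∞ | ∃ n : ℕ, e = n ∧ thick C n M}.Nonempty := by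
    by_contra hne
    rw [Set.not_nonempty_iff_eq_empty] at hne
    simp [level, hne] at h
  obtain ⟨n, hn, hM⟩ := csInf_mem hne
  rw [level] at h
  rw [h] at hn
  obtain rfl : l = n := by exact_mod_cast hn
  exact hM

end Ghost

end GLevel

namespace GLevel

open Abelian DerivedCategory

/-! ### Vanishing of Ext from Gorenstein projective to projective modules. -/

section Vanishing

variable {R : Type u} [CommRing R]

lemma shortExact_cycles {P : CochainComplex (ModuleCat.{u} R) ℤ} (hP : ∀ n, P.ExactAt n)
    (n : ℤ) : (ShortComplex.mk (P.iCycles n) (P.toCycles n (n + 1))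
      (by simp [← cancel_mono (P.iCycles (n + 1))])).ShortExact where
  exact := by
    let S := ShortComplex.mk (P.iCycles n) (P.toCycles n (n + 1))
      (by simp [← cancel_mono (P.iCycles (n + 1))])
    let S' := ShortComplex.mk (P.iCycles n) (P.d n (n + 1)) (by simp)
    let φ : S ⟶ S' :=
      { τ₁ := 𝟙 _
        τ₂ := 𝟙 _
        τ₃ := P.iCycles (n + 1) }
    have : Mono φ.τ₃ := inferInstanceAs (Mono (P.iCycles (n + 1)))
    rw [show ShortComplex.mk _ _ _ = S from rfl,
      ShortComplex.exact_iff_of_epi_of_isIso_of_mono φ]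
    exact ShortComplex.exact_of_f_is_kernel S' (P.cyclesIsKernel n (n + 1) (by simp))
  mono_f := inferInstanceAs (Mono (P.iCycles n))
  epi_g := by
    have h := (P.exactAt_iff' n (n + 1) (n + 1 + 1) (by simp) (by simp)).1 (hP (n + 1))
    have := h.epi_toCycles
    rw [← P.toCycles_cyclesIsoSc'_hom n (n + 1) (n + 1 + 1) (by simp) (by simp)] at this
    exact (epi_comp_iff_of_isIso _ (P.cyclesIsoSc' n (n + 1) (n + 1 + 1) _ _).hom).1 this

lemma IsTotallyAcyclic.ext_cycles_eq_zero {P : CochainComplex (ModuleCat.{u} R) ℤ}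
    (hP : IsTotallyAcyclic R P) {Q : ModuleCat.{u} R} (hQ : Projective Q) (i : ℕ) (n : ℤ)
    (e : Ext (P.cycles n) Q (i + 1)) : e = 0 := by
  induction i generalizing n with
  | zero =>
    obtain ⟨n, rfl⟩ : ∃ m, n = m + 1 + 1 := ⟨n - 1 - 1, by simp⟩
    have hS := shortExact_cycles hP.exact (n + 1)
    have := hP.projective (n + 1)
    obtain ⟨x, rfl⟩ := Ext.contravariant_sequence_exact₃ hS Q e
      (by exact Ext.eq_zero_of_projective _) (add_comm 1 0)
    obtain ⟨f, rfl⟩ := Ext.homEquiv₀.symm.surjective x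
    have hepi : Epi (P.toCycles n (n + 1)) := (shortExact_cycles hP.exact n).epi_g
    -- Total acyclicity extends `f` from the cycles to `P.X (n + 1)`, so its image under the
    -- connecting map vanishes.
    obtain ⟨g, hg⟩ := hP.hom_exact Q hQ n (P.toCycles n (n + 1) ≫ f) (by simp)
    rw [← P.toCycles_i n (n + 1), Category.assoc, cancel_epi] at hg
    subst hg
    rw [Ext.homEquiv₀_symm_apply, ← Ext.mk₀_comp_mk₀]
    exact ShortComplex.ShortExact.extClass_comp_assoc hS _
  | succ i ih =>
    obtain ⟨n, rfl⟩ : ∃ m, n = m + 1 := ⟨n - 1, by simp⟩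
    have := hP.projective n
    obtain ⟨x, rfl⟩ := Ext.contravariant_sequence_exact₃ (shortExact_cycles hP.exact n) Q e
      (by exact Ext.eq_zero_of_projective _) (add_comm 1 (i + 1))
    rw [ih n x, Ext.comp_zero]

lemma IsGorensteinProjective.ext_eq_zero {M Q : ModuleCat.{u} R}
    (hM : IsGorensteinProjective R M) (hQ : Projective Q) (i : ℕ) (e : Ext M Q (i + 1)) :
    e = 0 := by
  obtain ⟨P, hP, ⟨φ⟩⟩ := hM
  have h : e = (Ext.mk₀ φ.hom).comp ((Ext.mk₀ φ.inv).comp e (zero_add _)) (zero_add _) := by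
    simp
  rw [h, hP.ext_cycles_eq_zero hQ i 0 ((Ext.mk₀ φ.inv).comp e _), Ext.comp_zero]

end Vanishing

/-! ### Shifts of ghosts, and ghosts from short exact sequences. -/

section Shift

variable {T : Type*} [Category T] [HasShift T ℤ] [Preadditive T]
  [∀ n : ℤ, (shiftFunctor T n).Additive]

lemma eq_zero_of_shift_hom_eq_zero {A B : T} {k l : ℤ} (h : ∀ ψ : A ⟶ B⟦l⟧, ψ = 0)
    {m : ℤ} (hm : m + k = l) (φ : A⟦-k⟧ ⟶ B⟦m⟧) : φ = 0 := by
  apply (shiftFunctor T k).map_injective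
  have h₀ := h ((shiftNegShift A k).inv ≫ φ⟦k⟧' ≫ (shiftFunctorAdd' T m k l hm).inv.app B)
  rwa [Preadditive.IsIso.comp_left_eq_zero, Preadditive.IsIso.comp_right_eq_zero,
    ← Functor.map_zero (shiftFunctor T k)] at h₀

variable {C : ObjectProperty T}

lemma IsGhost.shift {A B : T} {f : A ⟶ B} (hf : IsGhost C f) (n : ℤ) :
    IsGhost C (f⟦n⟧') := by
  intro X hX g
  apply (shiftFunctor T (-n)).map_injective
  have h := hf ((C.shiftClosure ℤ).le_shift (-n) X hX) (g⟦-n⟧' ≫ (shiftShiftNeg A n).hom)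
  rw [Functor.map_zero, Functor.map_comp, ← cancel_mono (shiftShiftNeg B n).hom, zero_comp, ← h,
    Category.assoc, Category.assoc]
  congr 1
  exact (shiftFunctorCompIsoId T n (-n) (add_neg_cancel n)).hom.naturality f

end Shift

section Ghost

variable {R : Type u} [CommRing R] [HasDerivedCategory.{w} (ModuleCat.{u} R)]

/-- The connecting morphism of a short exact sequence whose first term is right orthogonal to
the Gorenstein projective modules is ghost. -/
lemma isGhost_singleδ {S : ShortComplex (ModuleCat.{u} R)} (hS : S.ShortExact)
    (h : ∀ M : ModuleCat.{u} R, IsGorensteinProjective R M → ∀ (i : ℕ)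
      (e : Ext M S.X₁ (i + 1)), e = 0) :
    IsGhost (finGorensteinProjective R) hS.singleδ := by
  rintro X ⟨Y, a, e, M, -, hM, ⟨e'⟩⟩ g
  let α : X ≅ ((singleFunctor _ 0).obj M)⟦a⟧ := e ≪≫ (shiftFunctor _ a).mapIso e'
  rw [← cancel_epi α.inv, comp_zero, ← Category.assoc]
  generalize α.inv ≫ g = φ
  -- For `a > 0` the source lies in negative degrees and already `φ` vanishes; for `a = -k ≤ 0` the
  -- composite is a class in Ext^(k+1)(M, X₁).
  obtain ha | ha := lt_or_ge 0 a
  · have := TStructure.t.isLE_shift ((singleFunctor _ 0).obj M) 0 a (-a)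
    rw [TStructure.t.zero φ (-a) 0, zero_comp]
  · obtain ⟨k, rfl⟩ : ∃ k : ℕ, a = -k := ⟨(-a).toNat, by lia⟩
    refine eq_zero_of_shift_hom_eq_zero (l := (k + 1 : ℕ)) (fun ψ => ?_) (by push_cast; ring)
      (φ ≫ hS.singleδ)
    obtain ⟨x, rfl⟩ := Ext.homEquiv.surjective ψ
    rw [h M hM k x]
    exact Ext.zero_hom _ _ _

/-- If `C` is right orthogonal to the Gorenstein projective modules, then each element of
`Ext M C n` is a composition of `n` ghost morphisms. -/
lemma isGhostPow_ext_hom {C : ModuleCat.{u} R}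
    (h : ∀ M : ModuleCat.{u} R, IsGorensteinProjective R M → ∀ (i : ℕ)
      (e : Ext M C (i + 1)), e = 0) {n : ℕ} {M : ModuleCat.{u} R} (e : Ext M C n) :
    IsGhostPow (finGorensteinProjective R) n e.hom := by
  induction n generalizing C with
  | zero => trivial
  | succ n ih =>
    let ⟨I, _, f, _⟩ := EnoughInjectives.presentation C
    have hS : (ShortComplex.mk f (cokernel.π f) (cokernel.condition f)).ShortExact :=
      { exact := ShortComplex.exact_cokernel f }
    obtain ⟨x, rfl⟩ := Ext.covariant_sequence_exact₁ M hS e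
      (by exact Ext.eq_zero_of_injective _) rfl
    have hx := ih (fun M hM i e => ?_) x
    · rw [Ext.comp_hom, ShortComplex.ShortExact.extClass_hom]
      exact hx.comp_isGhost (((isGhost_singleδ hS h).shift _).comp _)
    -- The cosyzygy inherits orthogonality by dimension shifting.
    · obtain ⟨y, rfl⟩ := Ext.covariant_sequence_exact₃ M hS e rfl (h M hM _ _)
      rw [Ext.eq_zero_of_injective y, Ext.zero_comp]

end Ghost

end GLevel

namespace GLevel

open Abelian DerivedCategory
open scoped ZeroObject

/-! ### Approximation of modules by perfect complexes. -/

section Perfect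

variable {R : Type u} [CommRing R]

lemma finite_projective_mappingCone {K L : CochainComplex (ModuleCat.{u} R) ℤ} (φ : K ⟶ L)
    (hK : ∀ n, Module.Finite R (K.X n) ∧ Projective (K.X n))
    (hL : ∀ n, Module.Finite R (L.X n) ∧ Projective (L.X n)) (n : ℤ) :
    Module.Finite R ((CochainComplex.mappingCone φ).X n) ∧ Projective ((CochainComplex.mappingCone φ).X n) := by
  obtain ⟨_, _⟩ := hK (n + 1)
  obtain ⟨_, _⟩ := hL n
  let e : (CochainComplex.mappingCone φ).X n ≅ K.X (n + 1) ⊞ L.X n :=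
    HomologicalComplex.homotopyCofiber.XIsoBiprod φ n (n + 1) rfl
  exact ⟨Module.Finite.equiv (e ≪≫ ModuleCat.biprodIsoProd _ _).toLinearEquiv.symm,
    Projective.of_iso e.symm inferInstance⟩

lemma finite_projective_single {F : ModuleCat.{u} R} [Module.Finite R F] [Projective F] (n : ℤ) :
    Module.Finite R (((CochainComplex.singleFunctor (ModuleCat.{u} R) 0).obj F).X n) ∧
      Projective (((CochainComplex.singleFunctor (ModuleCat.{u} R) 0).obj F).X n) := by
  by_cases hn : n = 0
  · subst hn
    let e : ((CochainComplex.singleFunctor (ModuleCat.{u} R) 0).obj F).X 0 ≅ F :=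
      HomologicalComplex.singleObjXSelf _ _ _
    exact ⟨Module.Finite.equiv e.toLinearEquiv.symm, Projective.of_iso e.symm inferInstance⟩
  · have h : IsZero (((CochainComplex.singleFunctor (ModuleCat.{u} R) 0).obj F).X n) :=
      HomologicalComplex.isZero_single_obj_X _ _ _ _ hn
    have := ModuleCat.subsingleton_of_isZero h
    exact ⟨inferInstance, h.projective⟩

variable [HasDerivedCategory.{w} (ModuleCat.{u} R)]

/-- Morphisms in the derived category from K-projective complexes are represented by morphisms
of complexes. -/
lemma exists_Q_map_eq {K L : CochainComplex (ModuleCat.{u} R) ℤ} [K.IsKProjective]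
    (f : Q.obj K ⟶ Q.obj L) : ∃ φ : K ⟶ L, Q.map φ = f := by
  obtain ⟨ψ, hψ⟩ := (CochainComplex.IsKProjective.Qh_map_bijective K
    ((HomotopyCategory.quotient _ _).obj L)).surjective
    ((quotientCompQhIso _).hom.app K ≫ f ≫ (quotientCompQhIso _).inv.app L)
  obtain ⟨φ, rfl⟩ := (HomotopyCategory.quotient _ _).map_surjective ψ
  refine ⟨φ, ?_⟩
  rw [← cancel_mono ((quotientCompQhIso _).inv.app L), quotientCompQhIso_inv_naturality, hψ]
  simp

/-- Truncated resolutions by finitely generated free modules. -/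
lemma exists_perfect_approximation [IsNoetherianRing R] (m : ℕ) (M : ModuleCat.{u} R)
    [Module.Finite R M] :
    ∃ P : CochainComplex (ModuleCat.{u} R) ℤ,
      (∀ n : ℤ, Module.Finite R (P.X n) ∧ Projective (P.X n)) ∧
      P.IsStrictlyGE (-m) ∧ P.IsStrictlyLE 0 ∧
      ∃ (Z : DerivedCategory (ModuleCat.{u} R))
        (π : Q.obj P ⟶ (DerivedCategory.singleFunctor _ 0).obj M)
        (a : (DerivedCategory.singleFunctor _ 0).obj M ⟶ Z) (b : Z ⟶ (Q.obj P)⟦(1 : ℤ)⟧),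
        Triangle.mk π a b ∈ distTriang _ ∧ Z.IsLE (-m) := by
  induction m generalizing M with
  | zero =>
    have h₀ : IsZero (Q.obj (0 : CochainComplex (ModuleCat.{u} R) ℤ)) :=
      Q.map_isZero (isZero_zero _)
    obtain ⟨Z, a, b, hT⟩ := distinguished_cocone_triangle
      (0 : Q.obj (0 : CochainComplex (ModuleCat.{u} R) ℤ) ⟶
        (DerivedCategory.singleFunctor _ 0).obj M)
    have : IsIso a := (Triangle.isZero₁_iff_isIso₂ _ hT).1 h₀
    refine ⟨0, fun n => ?_, ?_, ?_, Z, 0, a, b, hT, ?_⟩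
    · have h : IsZero ((0 : CochainComplex (ModuleCat.{u} R) ℤ).X n) :=
        (HomologicalComplex.eval _ _ n).map_isZero (isZero_zero _)
      have := ModuleCat.subsingleton_of_isZero h
      exact ⟨inferInstance, h.projective⟩
    · rw [CochainComplex.isStrictlyGE_iff]
      exact fun i _ => (HomologicalComplex.eval _ _ i).map_isZero (isZero_zero _)
    · rw [CochainComplex.isStrictlyLE_iff]
      exact fun i _ => (HomologicalComplex.eval _ _ i).map_isZero (isZero_zero _)
    · have := TStructure.t.isLE_of_iso (asIso a) 0
      simpa using this
  | succ m ih =>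
    obtain ⟨F, _, _, _, _, f, hf⟩ := Module.exists_finite_presentation R M
    have hS := LinearMap.shortExact_shortComplexKer hf
    obtain ⟨P, hP, _, _, Z, π, a, b, hT, _⟩ := ih f.shortComplexKer.X₁
    have := fun n => (hP n).2
    have := CochainComplex.isKProjective_of_projective P 0
    obtain ⟨φ, hφ⟩ := exists_Q_map_eq (L := (CochainComplex.singleFunctor _ 0).obj f.shortComplexKer.X₂)
      (π ≫ (DerivedCategory.singleFunctor _ 0).map f.shortComplexKer.f)
    refine ⟨CochainComplex.mappingCone φ, finite_projective_mappingCone φ hP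
      (fun n => finite_projective_single (F := f.shortComplexKer.X₂) n), ?_, ?_, ?_⟩
    · exact CochainComplex.isStrictlyGE_mappingCone φ (-m) 0 _
    · rw [CochainComplex.isStrictlyLE_iff]
      intro i hi
      rw [CochainComplex.mappingCone.isZero_X_iff]
      exact ⟨P.isZero_of_isStrictlyLE 0 _, CochainComplex.isZero_of_isStrictlyLE _ 0 _⟩
    have : Projective f.shortComplexKer.X₂ := inferInstance
    have hT₂ := mappingCone_triangle_distinguished φ
    -- The octahedron on `P ⟶ ker f ⟶ F` identifies the cone of the new approximation with `Z⟦1⟧`.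
    have H := Triangulated.someOctahedron hφ.symm hT hS.singleTriangle_distinguished hT₂
    refine ⟨Z⟦(1 : ℤ)⟧, H.m₃, _, _, rot_of_distTriang _ H.mem,
      TStructure.t.isLE_shift Z (-m) 1 (-(m + 1 : ℕ)) (by push_cast; ring)⟩

/-- The class factors through `Z`, in degrees at most `-m`, while `N⟦n⟧` sits in degree `-n > -m`.
-/
lemma eq_zero_of_perfect_approximation_comp_eq_zero {m : ℕ} {M : ModuleCat.{u} R}
    {X Z : DerivedCategory (ModuleCat.{u} R)}
    {π : X ⟶ (DerivedCategory.singleFunctor _ 0).obj M}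
    {a : (DerivedCategory.singleFunctor _ 0).obj M ⟶ Z} {b : Z ⟶ X⟦(1 : ℤ)⟧}
    (hT : Triangle.mk π a b ∈ distTriang _) [Z.IsLE (-m)] {N : ModuleCat.{u} R} {n : ℕ}
    (hn : n < m) (e : Ext M N n) (he : π ≫ e.hom = 0) : e = 0 := by
  obtain ⟨g, hg⟩ : ∃ g : Z ⟶ ((DerivedCategory.singleFunctor _ 0).obj N)⟦(n : ℤ)⟧,
    e.hom = a ≫ g := Triangle.yoneda_exact₂ _ hT e.hom he
  have := TStructure.t.isGE_shift ((DerivedCategory.singleFunctor _ 0).obj N) 0 n (-n)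
  ext
  rw [hg, TStructure.t.zero g (-m) (-n), comp_zero, Ext.zero_hom]

end Perfect

end GLevel

namespace GLevel

open Abelian

/-! ### Bass' lemma and the bound on the Krull dimension. -/

section Support

variable {R : Type u} [CommRing R]

/-- Local vanishing of Ext is expressed through supports, so that Ext never has to be compared with
Ext over a localization. -/
lemma notMem_support_ext_of_notMem_support {A : ModuleCat.{u} R} [Module.Finite R A]
    (N : ModuleCat.{u} R) {q : PrimeSpectrum R} (h : q ∉ Module.support R A) (i : ℕ) :
    q ∉ Module.support R (Ext A N i) := by
  rw [Module.mem_support_iff_of_finite, SetLike.not_le_iff_exists] at h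
  obtain ⟨s, hs, hsq⟩ := h
  rw [Module.notMem_support_iff']
  refine fun e => ⟨s, hsq, ?_⟩
  have h₀ : s • 𝟙 A = 0 := by
    ext a
    exact Module.mem_annihilator.1 hs a
  have h₁ : s • e = (Ext.mk₀ (s • 𝟙 A)).comp e (zero_add i) := by simp [Ext.mk₀_smul]
  rw [h₁, h₀, Ext.mk₀_zero, Ext.zero_comp]

lemma notMem_support_ext_of_shortExact {S : ShortComplex (ModuleCat.{u} R)} (hS : S.ShortExact)
    {N : ModuleCat.{u} R} {q : PrimeSpectrum R} {i : ℕ}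
    (h₁ : q ∉ Module.support R (Ext S.X₁ N i)) (h₃ : q ∉ Module.support R (Ext S.X₃ N i)) :
    q ∉ Module.support R (Ext S.X₂ N i) := by
  rw [Module.notMem_support_iff'] at h₁ h₃ ⊢
  intro e
  obtain ⟨s, hs, hse⟩ := h₁ ((Ext.mk₀ S.f).comp e (zero_add i))
  obtain ⟨x, hx⟩ := Ext.contravariant_sequence_exact₂ hS N (s • e) (by simpa using hse)
  obtain ⟨t, ht, htx⟩ := h₃ x
  refine ⟨t * s, q.2.mul_notMem ht hs, ?_⟩
  rw [mul_smul, ← hx, ← Ext.comp_smul, htx, Ext.comp_zero]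

lemma notMem_support_ext_of_iso {A B : ModuleCat.{u} R} (φ : A ≅ B) {N : ModuleCat.{u} R}
    {q : PrimeSpectrum R} {i : ℕ} (h : q ∉ Module.support R (Ext A N i)) :
    q ∉ Module.support R (Ext B N i) := by
  rw [Module.notMem_support_iff'] at h ⊢
  intro e
  obtain ⟨s, hs, hse⟩ := h ((Ext.mk₀ φ.hom).comp e (zero_add i))
  have he : e = (Ext.mk₀ φ.inv).comp ((Ext.mk₀ φ.hom).comp e (zero_add i)) (zero_add i) := by
    simp
  exact ⟨s, hs, by rw [he, ← Ext.comp_smul, hse, Ext.comp_zero]⟩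

variable [IsNoetherianRing R]

/-- If `Ext^i(R/q, N)` vanishes locally at `q`, then so does `Ext^i(A, N)` for all finitely
generated modules `A` whose support contains no primes properly contained in `q`. -/
lemma notMem_support_ext_of_finite (N : ModuleCat.{u} R) {q : PrimeSpectrum R} {i : ℕ}
    (hq : q ∉ Module.support R (Ext (ModuleCat.of R (R ⧸ q.asIdeal)) N i))
    (A : Type u) [AddCommGroup A] [Module R A] [hA : Module.Finite R A]
    (h : ∀ p ∈ Module.support R A, p ≤ q → p = q) :
    q ∉ Module.support R (Ext (ModuleCat.of R A) N i) := by
  induction hA using IsNoetherianRing.induction_on_isQuotientEquivQuotientPrime R with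
  | subsingleton A =>
    exact notMem_support_ext_of_notMem_support N (by simp [Module.support_eq_empty]) i
  | quotient A p e =>
    by_cases hpq : p ≤ q
    · have hp : p ∈ Module.support R A := by
        rw [e.support_eq, Module.mem_support_iff_of_finite, Ideal.annihilator_quotient]
      obtain rfl := h p hp hpq
      exact notMem_support_ext_of_iso e.toModuleIso.symm hq
    · refine notMem_support_ext_of_notMem_support (A := ModuleCat.of R A) N ?_ i
      rwa [e.support_eq, Module.mem_support_iff_of_finite, Ideal.annihilator_quotient]
  | exact A₁ A₂ A₃ f g hf hg hfg h₁ h₃ =>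
    have hs := Module.support_of_exact hfg hf hg
    let S : ShortComplex (ModuleCat.{u} R) :=
      ModuleCat.shortComplexOfCompEqZero f g hfg.linearMap_comp_eq_zero
    have hS : S.ShortExact := ModuleCat.shortComplex_shortExact S hfg hf hg
    exact notMem_support_ext_of_shortExact hS
      (h₁ fun p hp => h p (hs ▸ Or.inl hp)) (h₃ fun p hp => h p (hs ▸ Or.inr hp))

/-- Bass' lemma: if `q` is minimal over `p + (x)`, where `x ∉ p`, and `Ext^(i+1)(R/q, N)`
vanishes locally at `q`, then `Ext^i(R/p, N)` vanishes locally at `p`. -/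
lemma notMem_support_ext_quotient {N : ModuleCat.{u} R} [Module.Finite R N]
    {p q : PrimeSpectrum R} {x : R} (hx : x ∉ p.asIdeal)
    (hq : q.asIdeal ∈ (p.asIdeal ⊔ Ideal.span {x}).minimalPrimes) {i : ℕ}
    (h : q ∉ Module.support R (Ext (ModuleCat.of R (R ⧸ q.asIdeal)) N (i + 1))) :
    p ∉ Module.support R (Ext (ModuleCat.of R (R ⧸ p.asIdeal)) N i) := by
  let A := R ⧸ p.asIdeal
  have hpq : p ≤ q := le_sup_left.trans hq.1.2
  have hxq : x ∈ q.asIdeal := hq.1.2 (Ideal.mem_sup_right (Ideal.mem_span_singleton_self x))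
  let f : A →ₗ[R] A := LinearMap.lsmul R A x
  have hf : Function.Injective f := by
    rw [injective_iff_map_eq_zero]
    intro a ha
    obtain ⟨a, rfl⟩ := Ideal.Quotient.mk_surjective a
    have : Ideal.Quotient.mk p.asIdeal (x * a) = 0 := ha
    rw [Ideal.Quotient.eq_zero_iff_mem] at this ⊢
    exact (p.2.mem_or_mem this).resolve_left hx
  let S : ShortComplex (ModuleCat.{u} R) :=
    ModuleCat.shortComplexOfCompEqZero f (LinearMap.range f).mkQ
      f.exact_map_mkQ_range.linearMap_comp_eq_zero
  have hS : S.ShortExact := ModuleCat.shortComplex_shortExact S f.exact_map_mkQ_range hf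
    (Submodule.mkQ_surjective _)
  have h₃ : q ∉ Module.support R (Ext S.X₃ N (i + 1)) := by
    refine notMem_support_ext_of_finite N h (A ⧸ LinearMap.range f) fun P hP hPq => ?_
    rw [Module.mem_support_iff_of_finite] at hP
    refine le_antisymm hPq (hq.2 ⟨P.2, sup_le ?_ ?_⟩ hPq)
    · refine le_trans (fun r hr => Module.mem_annihilator.2 fun a => ?_) hP
      obtain ⟨a, rfl⟩ := Submodule.Quotient.mk_surjective _ a
      obtain ⟨a, rfl⟩ := Ideal.Quotient.mk_surjective a
      have h₀ : r • Ideal.Quotient.mk p.asIdeal a = 0 :=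
        Ideal.Quotient.eq_zero_iff_mem.2 (Ideal.mul_mem_right a _ hr)
      rw [← Submodule.Quotient.mk_smul, h₀, Submodule.Quotient.mk_zero]
    · rw [Ideal.span_singleton_le_iff_mem]
      refine hP (Module.mem_annihilator.2 fun a => ?_)
      obtain ⟨a, rfl⟩ := Submodule.Quotient.mk_surjective _ a
      rw [← Submodule.Quotient.mk_smul, Submodule.Quotient.mk_eq_zero]
      exact ⟨a, rfl⟩
  -- Nakayama at `q`: locally, multiplication by `x ∈ q` is surjective on this Ext, as its cokernel
  -- embeds in Ext^(i+1)(S.X₃, N).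
  have hE : q ∉ Module.support R (Ext S.X₂ N i) := by
    intro hE
    have hE' : q ∈ Module.support R (Ext S.X₂ N i ⧸
        (Ideal.span {x} • ⊤ : Submodule R (Ext S.X₂ N i))) := by
      rw [Module.support_quotient]
      exact ⟨hE, by simpa using hxq⟩
    revert hE'
    rw [imp_false, Module.notMem_support_iff']
    rw [Module.notMem_support_iff'] at h₃
    intro e
    obtain ⟨e, rfl⟩ := Submodule.Quotient.mk_surjective _ e
    obtain ⟨s, hs, hse⟩ := h₃ (hS.extClass.comp e (add_comm 1 i))
    obtain ⟨y, hy⟩ := Ext.contravariant_sequence_exact₁ hS N (s • e) (add_comm 1 i)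
      (by simpa using hse)
    refine ⟨s, hs, ?_⟩
    rw [← Submodule.Quotient.mk_smul, Submodule.Quotient.mk_eq_zero, ← hy]
    have hSf : S.f = x • 𝟙 _ := rfl
    rw [hSf, Ext.mk₀_smul, Ext.smul_comp, Ext.mk₀_id_comp]
    exact Submodule.smul_mem_smul (Ideal.mem_span_singleton_self x) Submodule.mem_top
  exact fun hp => hE (Module.mem_support_mono hpq hp)

/-- Bass' lemma carries the vanishing of Ext^t down a chain of primes, losing one degree per step.
-/
lemma notMem_support_ext_of_le_coheight {N : ModuleCat.{u} R} [Module.Finite R N] {t : ℕ}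
    (hN : HasInjectiveDimensionLT N t) {i j : ℕ} (hij : i + j = t) (p : PrimeSpectrum R)
    (hp : j ≤ Order.coheight p) :
    p ∉ Module.support R (Ext (ModuleCat.of R (R ⧸ p.asIdeal)) N i) := by
  induction j generalizing i p with
  | zero =>
    have := HasInjectiveDimensionLT.subsingleton N t i (by omega)
      (ModuleCat.of R (R ⧸ p.asIdeal))
    simp [Module.support_eq_empty]
  | succ j ih =>
    obtain ⟨l, rfl, hl⟩ := Order.exists_series_of_le_coheight p hp
    let k : Fin (l.length + 1) := ⟨1, by omega⟩
    have hlt : l.head < l k := l.strictMono (Fin.lt_def.2 (by simp [k]))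
    obtain ⟨x, hxk, hx⟩ := SetLike.exists_of_lt (PrimeSpectrum.asIdeal_lt_asIdeal _ _ |>.2 hlt)
    -- The chain need not be saturated: `l k` is replaced by a smaller prime `q`, whose coheight is
    -- no less.
    obtain ⟨q, hq, hqk⟩ := Ideal.exists_minimalPrimes_le
      (I := l.head.asIdeal ⊔ Ideal.span {x}) (J := (l k).asIdeal)
      (sup_le hlt.le (by simpa [Ideal.span_le] using hxk))
    let q' : PrimeSpectrum R := ⟨q, hq.1.1⟩
    refine notMem_support_ext_quotient (q := q') hx hq (ih (by omega) q' ?_)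
    refine le_trans ?_ ((Order.rev_index_le_coheight l k).trans
      (Order.coheight_anti (show q' ≤ l k from hqk)))
    norm_cast
    simp [k, hl]

/-- The Krull dimension of a noetherian ring is bounded by its self-injective dimension. -/
lemma lt_of_le_ringKrullDim {t : ℕ} (hR : HasInjectiveDimensionLT (ModuleCat.of R R) t) {n : ℕ}
    (hn : n ≤ ringKrullDim R) : n < t := by
  by_contra! htn
  obtain ⟨l, hl⟩ := Order.le_krullDim_iff.1 hn
  obtain ⟨p, hp, hpl⟩ := Ideal.exists_minimalPrimes_le (I := (⊥ : Ideal R)) (J := l.head.asIdeal)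
    bot_le
  let p' : PrimeSpectrum R := ⟨p, hp.1.1⟩
  refine notMem_support_ext_of_le_coheight hR (zero_add t) p' ?_ ?_
  · have h₁ : (l.length : ℕ∞) ≤ Order.coheight p' := Order.length_le_coheight hpl
    rw [hl] at h₁
    exact le_trans (by exact_mod_cast htn) h₁
  -- A minimal prime is associated, so Hom(R/p, R) contains a map with annihilator `p` and cannot
  -- vanish at `p`.
  · have hass : IsAssociatedPrime p R :=
      Module.associatedPrimes.minimalPrimes_annihilator_subset_associatedPrimes R R
        (by rwa [Module.annihilator_eq_bot.2 inferInstance])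
    obtain ⟨a, ha⟩ := (Submodule.isAssociatedPrime_iff.1 hass).2
    have hpa : ∀ r, r ∈ p ↔ r * a = 0 := fun r => by
      rw [ha, Submodule.mem_colon_singleton, smul_eq_mul, Submodule.mem_bot]
    let g : R ⧸ p →ₗ[R] R := Submodule.liftQ p (LinearMap.toSpanSingleton R R a)
      (fun r hr => (hpa r).1 hr)
    rw [Module.mem_support_iff']
    refine ⟨Ext.mk₀ (ModuleCat.ofHom g), fun r hr h₀ => hr ?_⟩
    rw [← Ext.mk₀_smul, Ext.mk₀_eq_zero_iff] at h₀
    have h₁ : r * g (Ideal.Quotient.mk p 1) = 0 :=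
      congr($(congr(ModuleCat.Hom.hom $h₀)) (Ideal.Quotient.mk p 1))
    have h₂ : g (Ideal.Quotient.mk p 1) = a := one_smul R a
    rwa [h₂, ← hpa] at h₁

end Support

end GLevel

namespace GLevel

open Abelian DerivedCategory

/-! ### Injective dimension of R and conclusion. -/

variable {R : Type u} [CommRing R]

/-- It suffices to test the injective dimension on finitely generated modules. -/
lemma hasInjectiveDimensionLT_of_finite {N : ModuleCat.{u} R} {n : ℕ}
    (h : ∀ M : ModuleCat.{u} R, Module.Finite R M → ∀ e : Ext M N n, e = 0) :
    HasInjectiveDimensionLT N n := by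
  induction n generalizing N with
  | zero =>
    rw [hasInjectiveDimensionLT_zero_iff_isZero, ModuleCat.isZero_iff_subsingleton,
      subsingleton_iff_forall_eq 0]
    intro x
    have h₀ := h (ModuleCat.of R R) inferInstance
      (Ext.mk₀ (ModuleCat.ofHom (LinearMap.toSpanSingleton R N x)))
    rw [Ext.mk₀_eq_zero_iff] at h₀
    have h₁ : (1 : R) • x = 0 := congr($(congr(ModuleCat.Hom.hom $h₀)) (1 : R))
    rwa [one_smul] at h₁
  | succ n ih =>
    let ⟨I, _, f, _⟩ := EnoughInjectives.presentation N
    have hS : (ShortComplex.mk f (cokernel.π f) (cokernel.condition f)).ShortExact :=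
      { exact := ShortComplex.exact_cokernel f }
    -- Baer's criterion starts the dimension shift at Ext^1; from Ext^1 to Hom it would fail, as
    -- Hom(M, I) need not vanish.
    obtain _ | n := n
    · rw [← injective_iff_hasInjectiveDimensionLT_one,
        ← Module.injective_iff_injective_object, ← Module.Baer.iff_injective]
      intro J g
      let T : ShortComplex (ModuleCat.{u} R) :=
        ModuleCat.shortComplexOfCompEqZero J.subtype J.mkQ
          (LinearMap.exact_subtype_mkQ J).linearMap_comp_eq_zero
      have hT : T.ShortExact := ModuleCat.shortComplex_shortExact T
        (LinearMap.exact_subtype_mkQ J) J.subtype_injective J.mkQ_surjective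
      obtain ⟨y, hy⟩ := Ext.contravariant_sequence_exact₁ hT N
        (Ext.mk₀ (ModuleCat.ofHom g : T.X₁ ⟶ N)) (add_zero 1)
        (h T.X₃ (inferInstanceAs (Module.Finite R (R ⧸ J))) _)
      obtain ⟨y, rfl⟩ := Ext.homEquiv₀.symm.surjective y
      rw [Ext.homEquiv₀_symm_apply, Ext.mk₀_comp_mk₀] at hy
      have hy' := (Ext.mk₀_bijective _ _).1 hy
      exact ⟨y.hom, fun x hx => congr($(congr(ModuleCat.Hom.hom $hy')) ⟨x, hx⟩)⟩
    · rw [← hS.hasInjectiveDimensionLT_X₃_iff n inferInstance]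
      refine ih fun M hM e => ?_
      obtain ⟨y, rfl⟩ := Ext.covariant_sequence_exact₃ M hS e rfl (h M hM _)
      rw [Ext.eq_zero_of_injective y, Ext.zero_comp]

lemma isGorenstein_of_hasInjectiveDimensionLE [IsNoetherianRing R] {n : ℕ}
    (h : HasInjectiveDimensionLE (ModuleCat.of R R) n) : IsGorenstein R := by
  intro p _
  refine ⟨n, ?_⟩
  let M := ModuleCat.of R R
  have : IsLocalizedModule p.primeCompl (M.localizedModuleMkLinearMap p.primeCompl) :=
    M.localizedModule_isLocalizedModule p.primeCompl
  let e : M.localizedModule p.primeCompl ≃ₗ[R] Localization.AtPrime p :=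
    IsLocalizedModule.linearEquiv p.primeCompl (M.localizedModuleMkLinearMap p.primeCompl)
      (Algebra.linearMap R (Localization.AtPrime p))
  exact (ModuleCat.hasInjectiveDimensionLE_iff_of_linearEquiv
    (e.extendScalarsOfIsLocalization p.primeCompl (Localization.AtPrime p)) n).1
    (M.localizedModule_hasInjectiveDimensionLE n p.primeCompl)

/-- If all perfect complexes can be built from the finitely generated Gorenstein projective
modules in at most `t` steps, then `Ext^t(M, R) = 0` for all finitely generated modules `M`. -/
lemma ext_eq_zero_of_thick [IsNoetherianRing R] [HasDerivedCategory.{w} (ModuleCat.{u} R)]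
    {t : ℕ} (h : ∀ P : DerivedCategory (ModuleCat.{u} R), IsPerfect R P →
      ∃ l ≤ t, thick (finGorensteinProjective R) l P)
    (M : ModuleCat.{u} R) [Module.Finite R M] (e : Ext M (ModuleCat.of R R) t) : e = 0 := by
  obtain ⟨P, hP, hGE, hLE, Z, π, a, b, hT, _⟩ := exists_perfect_approximation (t + 1) M
  obtain ⟨l, hl, hl'⟩ := h (Q.obj P) ⟨P, hP, ⟨_, _, hGE, hLE⟩, ⟨Iso.refl _⟩⟩
  have hproj : Projective (ModuleCat.of R R) := inferInstance
  exact eq_zero_of_perfect_approximation_comp_eq_zero hT t.lt_succ_self e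
    ((((isGhostPow_ext_hom (fun M hM i e => hM.ext_eq_zero hproj i e) e).of_le hl).precomp
      π).eq_zero_of_thick hl')

end GLevel

theorem mainTheorem1 (R : Type u) [CommRing R] [IsNoetherianRing R]
    [HasDerivedCategory.{w} (ModuleCat.{u} R)] (d : ℤ)
    (h : ∀ P : DerivedCategory (ModuleCat.{u} R), GLevel.IsPerfect R P →
      ∃ l : ℕ, GLevel.level (GLevel.finGorensteinProjective R) P = l ∧ (l : ℤ) ≤ d + 1) :
    GLevel.IsGorenstein R ∧
      ∀ n : ℕ, (n : WithBot ℕ∞) ≤ ringKrullDim R → (n : ℤ) ≤ d := by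
  have hdim : HasInjectiveDimensionLT (ModuleCat.of R R) (d + 1).toNat :=
    GLevel.hasInjectiveDimensionLT_of_finite fun M _ e =>
      GLevel.ext_eq_zero_of_thick (fun P hP => by
        obtain ⟨l, hl, hld⟩ := h P hP
        exact ⟨l, by omega, GLevel.exists_thick_of_level_eq hl⟩) M e
  -- One more than needed, which avoids a separate case when `(d + 1).toNat = 0`; only finiteness
  -- matters here.
  refine ⟨GLevel.isGorenstein_of_hasInjectiveDimensionLE (n := (d + 1).toNat)
    (hasInjectiveDimensionLT_of_ge _ _ _ (Nat.le_succ _)), fun n hn => ?_⟩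
  have := GLevel.lt_of_le_ringKrullDim hdim hn
  omega
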